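/- For $0<\lambda,\alpha\le 1$ let $L(\lambda,\alpha,s)$ be the Lerch zeta-function, that is, the analytic continuation of $$L(\lambda,\alpha,s)=\sum_{m=0}^{\infty}\frac{e^{2\pi i\lambda m}}{(m+\alpha)^{s}}\qquad(\Re s>1)$$ to the whole complex plane, except for a simple pole at $s=1$ when $\lambda=1$. Proposition. Let $0<\lambda,\alpha\le1$ and $\sigma_0\in\mathbb R$. There is a constant $C=C(\lambda,\alpha,\sigma_0)>0$ such that for every complex number $s=\sigma+it$ with $\sigma\ge\sigma_0$, $t\ge 2$ and $L(\lambda,\alpha,s)\ne0$, $$\frac{1}{|L(\lambda,\alpha,s)|}<\exp\bigl(C(|\log d|+1)\log t\bigr),$$ where $d$ is the distance from $s$ to the nearest zero (trivial or nontrivial, anywhere in the plane) of $L(\lambda,\alpha,\cdot)$. -/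

import Mathlib

namespace LerchZeta

open Complex MeasureTheory Filter Topology

/-- The domain of regularity of `L(lam, α, ·)`: the whole plane if `lam` is not `1`, and the plane
without the point `1` (a simple pole) if `lam = 1`. Here `0 < lam ≤ 1`. -/
def regularDomain (lam : ℝ) : Set ℂ := {s | lam = 1 → s ≠ 1}

/-- `f` is the analytic continuation of the Dirichlet series
`∑ exp (2 π i lam m) / (m + α) ^ s`, `Re s > 1`, to the domain of regularity. -/
structure IsContinuation (lam α : ℝ) (f : ℂ → ℂ) : Prop where
  differentiableOn : DifferentiableOn ℂ f (regularDomain lam)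
  hasSum : ∀ s : ℂ, 1 < s.re →
    HasSum (fun m : ℕ => cexp (2 * Real.pi * I * lam * m) / ((m : ℂ) + α) ^ s) (f s)

/-! ### Existence and uniqueness of the continuation -/

theorem differentiableOn_integral {U : Set ℂ} (hU : IsOpen U) {g : ℝ → ℂ → ℂ}
    (hc : ContinuousOn (Function.uncurry g) (Set.univ ×ˢ U))
    (hd : ∀ u, DifferentiableOn ℂ (g u) U) :
    DifferentiableOn ℂ (fun s => ∫ u in (0 : ℝ)..1, g u s) U := by
  intro s hs
  refine DifferentiableAt.differentiableWithinAt ?_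
  obtain ⟨r, hr, hrU⟩ := Metric.isOpen_iff.1 hU s hs
  have hcu : ∀ z ∈ U, Continuous fun u => g u z := fun z hz => by
    have := hc.comp_continuous (f := fun u : ℝ => (u, z)) (by fun_prop) (by simp [hz])
    exact this
  have hK : IsCompact ((Set.Icc (0 : ℝ) 1) ×ˢ Metric.closedBall s (r / 2)) :=
    isCompact_Icc.prod (isCompact_closedBall _ _)
  have hsub : Metric.closedBall s (r / 2) ⊆ U :=
    (Metric.closedBall_subset_ball (by linarith)).trans hrU
  obtain ⟨M, hM⟩ := hK.exists_bound_of_continuousOn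
    (hc.mono (Set.prod_mono (Set.subset_univ _) hsub))
  have hU' : U ∈ 𝓝 s := hU.mem_nhds hs
  refine (intervalIntegral.hasDerivAt_integral_of_dominated_loc_of_deriv_le
    (F := fun z u => g u z) (F' := fun z u => deriv (g u) z) (bound := fun _ => M / (r / 4))
    (Metric.ball_mem_nhds s (show 0 < r / 4 by linarith)) ?_ ?_ ?_ ?_ ?_ ?_).2.differentiableAt
  · filter_upwards [hU'] with z hz
    exact (hcu z hz).aestronglyMeasurable
  · exact (hcu s hs).intervalIntegrable _ _
  · have hlim : Tendsto (fun n : ℕ => s + (r / 2) * (1 / ((n : ℂ) + 1))) atTop (𝓝[≠] s) := by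
      refine tendsto_nhdsWithin_iff.2 ⟨?_, Eventually.of_forall fun n => ?_⟩
      · simpa using ((tendsto_one_div_add_atTop_nhds_zero_nat (𝕜 := ℂ)).const_mul
          ((r : ℂ) / 2)).const_add s
      · have h1 : (r : ℂ) ≠ 0 := by exact_mod_cast hr.ne'
        have h2 : (n : ℂ) + 1 ≠ 0 := by exact_mod_cast n.succ_ne_zero
        simp [h1, h2]
    have hmem : ∀ n : ℕ, s + (r / 2) * (1 / ((n : ℂ) + 1)) ∈ U := fun n => by
      apply hsub
      have h2 : ‖(n : ℂ) + 1‖ = n + 1 := by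
        rw [show (n : ℂ) + 1 = ((n + 1 : ℕ) : ℂ) by push_cast; ring, Complex.norm_natCast]
        push_cast; ring
      rw [mem_closedBall_iff_norm, add_sub_cancel_left, norm_mul, norm_div, norm_div, h2]
      simp only [norm_real, Real.norm_eq_abs, abs_of_pos hr, norm_ofNat, norm_one]
      have : (1 : ℝ) / ((n : ℝ) + 1) ≤ 1 := by
        rw [div_le_one (by positivity)]; linarith [n.cast_nonneg (α := ℝ)]
      nlinarith
    refine aestronglyMeasurable_of_tendsto_ae (u := atTop)
      (f := fun (n : ℕ) u => slope (g u) s (s + (r / 2) * (1 / ((n : ℂ) + 1)))) (fun n => ?_)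
      (Eventually.of_forall fun u => ?_)
    · have : Continuous fun u => slope (g u) s (s + (r / 2) * (1 / ((n : ℂ) + 1))) := by
        simp only [slope_def_field]
        exact ((hcu _ (hmem n)).sub (hcu _ hs)).div_const _
      exact this.aestronglyMeasurable
    · exact (((hd u).differentiableAt hU').hasDerivAt.tendsto_slope).comp hlim
  · refine Eventually.of_forall fun u hu z hz => ?_
    rw [Set.uIoc_of_le zero_le_one] at hu
    have hzs : Metric.closedBall z (r / 4) ⊆ Metric.closedBall s (r / 2) := by
      refine Metric.closedBall_subset_closedBall' ?_
      have := Metric.mem_ball.1 hz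
      linarith
    refine norm_deriv_le_of_forall_mem_sphere_norm_le (by linarith) ?_ fun x hx => ?_
    · refine DifferentiableOn.diffContOnCl_ball (hd u) (hzs.trans hsub)
    · exact hM (u, x) ⟨⟨hu.1.le, hu.2⟩, hzs (Metric.sphere_subset_closedBall hx)⟩
  · exact intervalIntegrable_const
  · refine Eventually.of_forall fun u _ z hz => ?_
    have hzU : z ∈ U := hrU (Metric.ball_subset_ball (by linarith) hz)
    exact ((hd u).differentiableAt (hU.mem_nhds hzU)).hasDerivAt

/-- Auxiliary continuations to `Re s > 1 - k`, from the identity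
`(1 - w) L(a, s) = a ^ (-s) - s w ∫ u in 0..1, L(a + u, s + 1)`. -/
noncomputable def aux (w : ℂ) : ℕ → ℝ → ℂ → ℂ
  | 0, a, s => (a : ℂ) ^ (-s) + ∑' m : ℕ, w ^ (m + 1) * ((m : ℂ) + 1 + a) ^ (-s)
  | k + 1, a, s =>
      ((a : ℂ) ^ (-s) - s * w * ∫ u in (0 : ℝ)..1, aux w k (a + |u|) (s + 1)) / (1 - w)

theorem term_bound {w : ℂ} (hw : ‖w‖ = 1) {σ : ℝ} {a : ℝ} (ha : 0 < a) {s : ℂ}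
    (hσ : 0 ≤ σ) (hs : σ ≤ s.re) (m : ℕ) :
    ‖w ^ (m + 1) * ((m : ℂ) + 1 + a) ^ (-s)‖ ≤ 1 / ((m + 1 : ℕ) : ℝ) ^ σ := by
  have h1 : (0 : ℝ) < (m : ℝ) + 1 + a := by positivity
  have h2 : ((m : ℂ) + 1 + a) = (((m : ℝ) + 1 + a : ℝ) : ℂ) := by push_cast; ring
  rw [norm_mul, norm_pow, hw, one_pow, one_mul, h2, norm_cpow_eq_rpow_re_of_pos h1, neg_re,
    one_div, ← Real.rpow_neg (by positivity)]
  have hm : (0 : ℝ) ≤ m := m.cast_nonneg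
  calc ((m : ℝ) + 1 + a) ^ (-s.re) ≤ ((m : ℝ) + 1 + a) ^ (-σ) :=
        Real.rpow_le_rpow_of_exponent_le (by linarith) (by linarith)
    _ ≤ ((m + 1 : ℕ) : ℝ) ^ (-σ) :=
        Real.rpow_le_rpow_of_nonpos (by positivity) (by push_cast; linarith) (by linarith)

theorem bound_summable {σ : ℝ} (h : 1 < σ) : Summable fun m : ℕ => 1 / ((m + 1 : ℕ) : ℝ) ^ σ :=
  (summable_nat_add_iff (f := fun n : ℕ => 1 / (n : ℝ) ^ σ) 1).2
    (Real.summable_one_div_nat_rpow.2 h)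

theorem hasSum_aux_zero {w : ℂ} (hw : ‖w‖ = 1) {a : ℝ} (ha : 0 < a) {s : ℂ} (hs : 1 < s.re) :
    HasSum (fun m : ℕ => w ^ m * ((m : ℂ) + a) ^ (-s)) (aux w 0 a s) := by
  have hsum : Summable fun m : ℕ => w ^ (m + 1) * ((m : ℂ) + 1 + a) ^ (-s) :=
    Summable.of_norm_bounded (bound_summable hs)
      fun m => term_bound hw ha (by linarith) le_rfl m
  have := hsum.hasSum
  rw [← hasSum_nat_add_iff' 1]
  simpa [aux] using this

theorem continuousAt_cpow_neg {b : ℝ} (hb : 0 ≤ b) {a : ℝ} (ha : 0 < a) (s : ℂ) :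
    ContinuousAt (fun p : ℝ × ℂ => ((b : ℂ) + (p.1 : ℂ)) ^ (-p.2)) (a, s) := by
  refine ContinuousAt.cpow (by fun_prop) (by fun_prop) (Or.inl ?_)
  simp
  linarith

theorem aux_props {w : ℂ} (hw : ‖w‖ = 1) (k : ℕ) :
    ContinuousOn (fun p : ℝ × ℂ => aux w k p.1 p.2) {p | 0 < p.1 ∧ 1 - (k : ℝ) < p.2.re} ∧
    ∀ a : ℝ, 0 < a → DifferentiableOn ℂ (aux w k a) {s | 1 - (k : ℝ) < s.re} := by
  have hdiff : ∀ b : ℝ, 0 < b → Differentiable ℂ fun s : ℂ => (b : ℂ) ^ (-s) := fun b hb =>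
    (differentiable_neg).const_cpow (Or.inl (by exact_mod_cast hb.ne'))
  induction k with
  | zero =>
    constructor
    · rintro ⟨a, s⟩ ⟨ha, hs⟩
      simp only [Nat.cast_zero, sub_zero] at ha hs
      obtain ⟨σ, h1, h2⟩ := exists_between hs
      refine ContinuousAt.continuousWithinAt (ContinuousAt.add ?_ ?_)
      · simpa using continuousAt_cpow_neg (b := 0) le_rfl ha s
      · have hO : {p : ℝ × ℂ | 0 < p.1 ∧ σ < p.2.re} ∈ 𝓝 (a, s) :=
          ((isOpen_lt continuous_const continuous_fst).inter
            (isOpen_lt continuous_const (continuous_re.comp continuous_snd))).mem_nhds ⟨ha, h2⟩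
        refine ContinuousOn.continuousAt (continuousOn_tsum (fun m => ?_) (bound_summable h1)
          fun m p hp => term_bound hw hp.1 (by linarith) hp.2.le m) hO
        rintro ⟨b, z⟩ ⟨hb, hz⟩
        refine ContinuousAt.continuousWithinAt (continuousAt_const.mul ?_)
        simpa using continuousAt_cpow_neg (b := (m : ℝ) + 1) (by positivity) hb z
    · intro a ha s hs
      simp only [Nat.cast_zero, sub_zero, Set.mem_ofPred_eq] at hs
      obtain ⟨σ, h1, h2⟩ := exists_between hs
      have hop : IsOpen {z : ℂ | σ < z.re} := isOpen_lt continuous_const continuous_re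
      refine DifferentiableAt.differentiableWithinAt ((hdiff a ha s).add ?_)
      refine (differentiableOn_tsum_of_summable_norm (bound_summable h1) (fun m => ?_) hop
        fun m z hz => term_bound hw ha (by linarith) (le_of_lt hz) m).differentiableAt
          (hop.mem_nhds h2)
      have := hdiff ((m : ℝ) + 1 + a) (by positivity)
      push_cast at this
      exact (this.const_mul _).differentiableOn
  | succ k ih =>
    obtain ⟨ihc, ihd⟩ := ih
    constructor
    · refine ContinuousOn.div_const (ContinuousOn.sub ?_ (ContinuousOn.mul (by fun_prop) ?_)) _
      · rintro ⟨a, s⟩ ⟨ha, -⟩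
        simpa using (continuousAt_cpow_neg (b := 0) le_rfl ha s).continuousWithinAt
      · rw [continuousOn_iff_continuous_domRestrict]
        refine intervalIntegral.continuous_parametric_intervalIntegral_of_continuous'
          (f := fun (p : {p : ℝ × ℂ | 0 < p.1 ∧ 1 - ((k + 1 : ℕ) : ℝ) < p.2.re}) (u : ℝ) =>
            aux w k (p.1.1 + |u|) (p.1.2 + 1)) ?_ 0 1
        refine ihc.comp_continuous
          (f := fun q : {p : ℝ × ℂ | 0 < p.1 ∧ 1 - ((k + 1 : ℕ) : ℝ) < p.2.re} × ℝ =>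
            (q.1.1.1 + |q.2|, q.1.1.2 + 1)) (by fun_prop) ?_
        rintro ⟨⟨⟨a, s⟩, ha, hs⟩, u⟩
        simp only [Nat.cast_add, Nat.cast_one] at ha hs
        refine ⟨by positivity, ?_⟩
        simp only [add_re, one_re]
        linarith
    · intro a ha
      have hop : IsOpen {z : ℂ | 1 - ((k + 1 : ℕ) : ℝ) < z.re} :=
        isOpen_lt continuous_const continuous_re
      have hmaps : Set.MapsTo (fun z : ℂ => z + 1) {z : ℂ | 1 - ((k + 1 : ℕ) : ℝ) < z.re}
          {z : ℂ | 1 - (k : ℝ) < z.re} := by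
        intro z hz
        simp only [Nat.cast_add, Nat.cast_one, Set.mem_ofPred_eq, add_re, one_re] at hz ⊢
        linarith
      refine DifferentiableOn.div_const (((hdiff a ha).differentiableOn).sub
        (DifferentiableOn.mul (by fun_prop) ?_)) _
      refine differentiableOn_integral (g := fun u s => aux w k (a + |u|) (s + 1)) hop ?_ ?_
      · refine ihc.comp (f := fun q : ℝ × ℂ => (a + |q.1|, q.2 + 1))
          (Continuous.continuousOn (by fun_prop)) ?_
        rintro ⟨u, z⟩ ⟨-, hz⟩
        exact ⟨by positivity, hmaps hz⟩
      · intro u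
        exact (ihd (a + |u|) (by positivity)).comp (by fun_prop) hmaps

theorem integral_term {b : ℝ} (hb : 0 < b) {s : ℂ} (hs : 0 < s.re) :
    s * ∫ u in (0 : ℝ)..1, ((b : ℂ) + (|u| : ℝ)) ^ (-(s + 1)) =
      (b : ℂ) ^ (-s) - ((b : ℂ) + 1) ^ (-s) := by
  have hs0 : s ≠ 0 := fun h => by simp [h] at hs
  have h1 : ∫ u in (0 : ℝ)..1, ((b : ℂ) + (|u| : ℝ)) ^ (-(s + 1)) =
      ∫ u in (0 : ℝ)..1, (((b + u : ℝ)) : ℂ) ^ (-(s + 1)) := by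
    refine intervalIntegral.integral_congr fun u hu => ?_
    rw [Set.uIcc_of_le zero_le_one] at hu
    simp [abs_of_nonneg hu.1]
  rw [h1, intervalIntegral.integral_comp_add_left (fun x : ℝ => (x : ℂ) ^ (-(s + 1))) b,
    integral_cpow (Or.inr ⟨?_, ?_⟩)]
  · have : -(s + 1) + 1 = -s := by ring
    rw [this]
    push_cast
    field_simp
    simp
  · intro h
    exact hs0 (by linear_combination -h)
  · rw [Set.uIcc_of_le (by linarith)]
    intro h
    linarith [h.1]

theorem aux_one_eq {w : ℂ} (hw : ‖w‖ = 1) (hw1 : w ≠ 1) {a : ℝ} (ha : 0 < a) {s : ℂ}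
    (hs : 1 < s.re) : aux w 1 a s = aux w 0 a s := by
  have hw1' : 1 - w ≠ 0 := sub_ne_zero.2 (Ne.symm hw1)
  have hs1 : 1 < (s + 1).re := by simp; linarith
  have hint : HasSum (fun m : ℕ => ∫ u in (0 : ℝ)..1,
      w ^ m * (((m : ℝ) + a : ℝ) + (|u| : ℝ) : ℂ) ^ (-(s + 1)))
      (∫ u in (0 : ℝ)..1, aux w 0 (a + |u|) (s + 1)) := by
    have hcont : ∀ m : ℕ, Continuous fun u : ℝ =>
        w ^ m * (((m : ℝ) + a : ℝ) + (|u| : ℝ) : ℂ) ^ (-(s + 1)) := fun m => by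
      refine continuous_const.mul (Continuous.cpow (by fun_prop) (by fun_prop) fun u => Or.inl ?_)
      rw [← ofReal_add, ofReal_re]
      positivity
    refine intervalIntegral.hasSum_integral_of_dominated_convergence
      (bound := fun m _ => ((m : ℝ) + a) ^ (-(s + 1).re)) (fun m => (hcont m).aestronglyMeasurable)
      (fun m => Eventually.of_forall fun u _ => ?_) (Eventually.of_forall fun u _ => ?_)
      intervalIntegrable_const (Eventually.of_forall fun u _ => ?_)
    · have h0 : (0 : ℝ) < (m : ℝ) + a := by positivity
      have hu := abs_nonneg u
      rw [norm_mul, norm_pow, hw, one_pow, one_mul, ← ofReal_add,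
        norm_cpow_eq_rpow_re_of_pos (by positivity), neg_re]
      exact Real.rpow_le_rpow_of_nonpos h0 (by linarith) (by linarith)
    · have := (hasSum_aux_zero (w := w) hw ha hs1).summable.norm
      refine this.congr fun m => ?_
      have h0 : (0 : ℝ) < (m : ℝ) + a := by positivity
      rw [norm_mul, norm_pow, hw, one_pow, one_mul,
        show (m : ℂ) + a = (((m : ℝ) + a : ℝ) : ℂ) by push_cast; ring,
        norm_cpow_eq_rpow_re_of_pos h0, neg_re]
    · have := hasSum_aux_zero (w := w) hw (a := a + |u|) (by positivity) hs1
      refine this.congr_fun fun m => ?_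
      congr 2
      push_cast
      ring
  have hA := hasSum_aux_zero (w := w) hw ha hs
  have hB : HasSum (fun m : ℕ => w ^ (m + 1) * (((m + 1 : ℕ) : ℂ) + a) ^ (-s))
      (aux w 0 a s - (a : ℂ) ^ (-s)) := by
    have := (hasSum_nat_add_iff' 1).2 hA
    simpa using this
  have hC := (hint.mul_left (s * w))
  have hD := (hA.mul_left w).sub hB
  have hEq : s * w * (∫ u in (0 : ℝ)..1, aux w 0 (a + |u|) (s + 1)) =
      w * aux w 0 a s - (aux w 0 a s - (a : ℂ) ^ (-s)) := by
    refine hC.unique (hD.congr_fun ?_)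
    intro m
    have hb : (0 : ℝ) < (m : ℝ) + a := by positivity
    have := integral_term hb (s := s) (by linarith)
    rw [intervalIntegral.integral_const_mul]
    push_cast at this ⊢
    rw [show (m : ℂ) + 1 + a = m + a + 1 by ring]
    linear_combination (w ^ (m + 1)) * this
  rw [aux.eq_2, hEq]
  field_simp
  ring

theorem aux_succ_eq {w : ℂ} (hw : ‖w‖ = 1) (hw1 : w ≠ 1) (k : ℕ) :
    ∀ {a : ℝ}, 0 < a → ∀ {s : ℂ}, 1 - (k : ℝ) < s.re → aux w (k + 1) a s = aux w k a s := by
  induction k with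
  | zero => intro a ha s hs; exact aux_one_eq hw hw1 ha (by simpa using hs)
  | succ k ih =>
    intro a ha s hs
    rw [aux, aux]
    congr 3
    refine intervalIntegral.integral_congr fun u _ => ?_
    refine ih (a := a + |u|) (by positivity) (s := s + 1) ?_
    push_cast at hs
    simp
    linarith

theorem aux_eq_of_le {w : ℂ} (hw : ‖w‖ = 1) (hw1 : w ≠ 1) {a : ℝ} (ha : 0 < a) {s : ℂ} {k l : ℕ}
    (hkl : k ≤ l) (hs : 1 - (k : ℝ) < s.re) : aux w l a s = aux w k a s := by
  induction l, hkl using Nat.le_induction with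
  | base => rfl
  | succ l hl ih =>
    rw [aux_succ_eq hw hw1 l ha, ih]
    have : (k : ℝ) ≤ l := by exact_mod_cast hl
    linarith

/-- The analytic continuation of the Lerch series exists. -/
theorem exists_isContinuation {lam α : ℝ} (hlam : 0 < lam) (hlam1 : lam ≤ 1) (hα : 0 < α)
    (hα1 : α ≤ 1) : ∃ f : ℂ → ℂ, IsContinuation lam α f := by
  rcases hlam1.eq_or_lt with rfl | hlt
  · refine ⟨HurwitzZeta.hurwitzZeta α, fun s hs => ?_, fun s hs => ?_⟩
    · exact (HurwitzZeta.differentiableAt_hurwitzZeta _ (hs rfl)).differentiableWithinAt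
    · refine (HurwitzZeta.hasSum_hurwitzZeta_of_one_lt_re ⟨hα.le, hα1⟩ hs).congr_fun fun m => ?_
      congr 1
      rw [exp_eq_one_iff]
      exact ⟨m, by push_cast; ring⟩
  · set w : ℂ := cexp (2 * Real.pi * I * lam) with hwdef
    have hw : ‖w‖ = 1 := by
      rw [hwdef, show (2 * Real.pi * I * lam : ℂ) = ((2 * Real.pi * lam : ℝ) : ℂ) * I by
        push_cast; ring, norm_exp_ofReal_mul_I]
    have hw1 : w ≠ 1 := by
      intro h
      obtain ⟨n, hn⟩ := exp_eq_one_iff.1 h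
      have hpi : (2 * Real.pi * I : ℂ) ≠ 0 := two_pi_I_ne_zero
      have h2 : (lam : ℂ) = n := mul_left_cancel₀ hpi (by rw [hn]; ring)
      have h3 : lam = n := by exact_mod_cast h2
      rw [h3] at hlam hlt
      have h4 : (0 : ℤ) < n := by exact_mod_cast hlam
      have h5 : n < (1 : ℤ) := by exact_mod_cast hlt
      omega
    have key : ∀ (k : ℕ) (s : ℂ), 1 - (k : ℝ) < s.re →
        aux w (⌊|s.re|⌋₊ + 2) α s = aux w k α s := by
      intro k s hs
      have h1 : 1 - ((⌊|s.re|⌋₊ + 2 : ℕ) : ℝ) < s.re := by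
        have := Nat.lt_floor_add_one |s.re|
        have := neg_abs_le s.re
        push_cast
        linarith
      rcases le_total k (⌊|s.re|⌋₊ + 2) with h | h
      · exact aux_eq_of_le hw hw1 hα h hs
      · exact (aux_eq_of_le hw hw1 hα h h1).symm
    refine ⟨fun s => aux w (⌊|s.re|⌋₊ + 2) α s, fun s _ => ?_, fun s hs => ?_⟩
    · obtain ⟨k, hk⟩ := exists_nat_gt (1 - s.re)
      have hop : IsOpen {z : ℂ | 1 - (k : ℝ) < z.re} := isOpen_lt continuous_const continuous_re
      have hsm : s ∈ {z : ℂ | 1 - (k : ℝ) < z.re} := by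
        simp only [Set.mem_ofPred_eq]; linarith
      have hd := ((aux_props hw k).2 α hα).differentiableAt (hop.mem_nhds hsm)
      refine (hd.congr_of_eventuallyEq ?_).differentiableWithinAt
      filter_upwards [hop.mem_nhds hsm] with z hz using key k z hz
    · rw [key 0 s (by simpa using hs)]
      refine (hasSum_aux_zero hw hα hs).congr_fun fun m => ?_
      rw [cpow_neg, div_eq_mul_inv, hwdef, ← Complex.exp_nat_mul]
      congr 2
      ring

/-- The analytic continuation is unique on the domain of regularity. -/
theorem IsContinuation.eqOn {lam α : ℝ} {f g : ℂ → ℂ} (hf : IsContinuation lam α f)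
    (hg : IsContinuation lam α g) : Set.EqOn f g (regularDomain lam) := by
  have hdom : IsOpen (regularDomain lam) ∧ IsPreconnected (regularDomain lam) := by
    by_cases h : lam = 1
    · have : regularDomain lam = {1}ᶜ := by ext s; simp [regularDomain, h]
      rw [this]
      exact ⟨isOpen_compl_singleton, (isConnected_compl_singleton_of_one_lt_rank
        (by rw [Complex.rank_real_complex]; norm_num) 1).isPreconnected⟩
    · have : regularDomain lam = Set.univ := by ext s; simp [regularDomain, h]
      rw [this]
      exact ⟨isOpen_univ, isPreconnected_univ⟩
  have h2 : (2 : ℂ) ∈ regularDomain lam := fun _ => by norm_num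
  refine (hf.differentiableOn.analyticOnNhd hdom.1).eqOn_of_preconnected_of_eventuallyEq
    (hg.differentiableOn.analyticOnNhd hdom.1) hdom.2 h2 ?_
  have hop : IsOpen {z : ℂ | 1 < z.re} := isOpen_lt continuous_const continuous_re
  filter_upwards [hop.mem_nhds (show (2 : ℂ) ∈ {z : ℂ | 1 < z.re} by simp)] with z hz
  exact (hf.hasSum z hz).unique (hg.hasSum z hz)

end LerchZeta

open Classical in
/-- The Lerch zeta-function `L(lam, α, s)`: the analytic continuation of its Dirichlet series.
It exists for `0 < lam, α ≤ 1` (outside this range the value is a placeholder). At the pole `s = 1`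
for `lam = 1` the value is not determined. -/
noncomputable def lerchZeta (lam α : ℝ) : ℂ → ℂ :=
  if h : ∃ f : ℂ → ℂ, LerchZeta.IsContinuation lam α f then h.choose else 0

theorem lerchZeta_isContinuation {lam α : ℝ} (hlam : 0 < lam) (hlam1 : lam ≤ 1) (hα : 0 < α)
    (hα1 : α ≤ 1) : LerchZeta.IsContinuation lam α (lerchZeta lam α) := by
  have h := LerchZeta.exists_isContinuation hlam hlam1 hα hα1
  rw [lerchZeta, dif_pos h]
  exact h.choose_spec

/-- The set of all zeros of `L(lam, α, ·)`, trivial and nontrivial; the pole is not counted,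
whatever the value of `lerchZeta` there. -/
def lerchZeros (lam α : ℝ) : Set ℂ :=
  {ρ | ρ ∈ LerchZeta.regularDomain lam ∧ lerchZeta lam α ρ = 0}

/-! The function G(s) = (s - 1) L(λ, α, s) is entire and grows polynomially on vertical strips
(`exists_entire`). At p = 3 + it the first term of the Dirichlet series dominates, so |L(p)| ≥ 1/2
and |G(p)| ≥ 1 (`half_le_norm_lerchZeta`). On a disc of fixed radius 4r about p one has |G| ≤ M =
t^B.

Such a function can be small only near a zero. Dividing by the Blaschke factor, for the disc of
radius 4r, of a zero within 2r of p keeps the bound M and at least doubles the modulus at p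
(`exists_blaschke_quotient`). Hence at most log M / log 2 = O(log t) divisions are possible. At a
point s within r of p, each one costs a factor at least D / (8r), where D ≤ 1 bounds from below the
distance from s to the zeros. What remains has no zeros within 2r of p, and Borel-Carathéodory
applied to its logarithm bounds it below by 1 / (4M²) (`norm_lower_bound_of_ne_zero`). So |G(s)| ≥
(D / 8r)^(O(log t)) t^(-O(1)), which is the claim for Re s ≤ 3; for Re s ≥ 3 the Dirichlet series
suffices.

Polynomial growth comes from recursions that express the function at s by an integral of the
function at s + 1: the one defining `aux` if λ < 1, and a Taylor variant, `hurwitzAux`, if λ = 1. -/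

section

/-! ### Lower bounds for holomorphic functions away from their zeros -/

open Complex Metric

/-- A zero-free holomorphic function on a disc cannot be much smaller at half the radius than at
the centre. -/
theorem norm_lower_bound_of_ne_zero {F : ℂ → ℂ} {r M : ℝ} (hr : 0 < r)
    (hF : DifferentiableOn ℂ F (ball 0 (2 * r))) (hM : ∀ z ∈ ball (0 : ℂ) (2 * r), ‖F z‖ ≤ M)
    (h0 : 1 ≤ ‖F 0‖) (hne : ∀ z ∈ ball (0 : ℂ) (2 * r), F z ≠ 0) {z : ℂ} (hz : ‖z‖ ≤ r) :
    1 / (4 * M ^ 2) ≤ ‖F z‖ := by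
  set U := ball (0 : ℂ) (2 * r) with hU
  have hUo : IsOpen U := isOpen_ball
  have h0U : (0 : ℂ) ∈ U := mem_ball_self (by linarith)
  have hzU : z ∈ U := by rw [hU, mem_ball_zero_iff]; linarith
  have hFat : ∀ x ∈ U, HasDerivAt F (deriv F x) x := fun x hx =>
    (hF.differentiableAt (hUo.mem_nhds hx)).hasDerivAt
  -- A primitive of F'/F vanishing at 0, that is, a logarithm of F / F(0).
  obtain ⟨g, hg0, hg⟩ := (DifferentiableOn.isExactOn_ball
    ((hF.deriv hUo).div hF hne)).with_val_at 0 0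
  have hconst : ∀ x ∈ U, F x = F 0 * exp (g x) := by
    intro x hx
    have hd : ∀ y ∈ U, HasDerivAt (fun y => F y * exp (-g y)) 0 y := fun y hy => by
      have h1 := (hFat y hy).mul (hg y hy).neg.cexp
      refine h1.congr_deriv ?_
      have := hne y hy
      simp only [Pi.div_apply, Pi.neg_apply]
      field_simp
      ring
    have := (convex_ball (0 : ℂ) (2 * r)).is_const_of_fderivWithin_eq_zero (𝕜 := ℂ)
      (f := fun y => F y * exp (-g y))
      (fun y hy => (hd y hy).differentiableAt.differentiableWithinAt)
      (fun y hy => by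
        rw [fderivWithin_of_isOpen hUo hy]
        ext
        simp [(hd y hy).deriv]) hx h0U
    simp only [hg0, neg_zero, exp_zero, mul_one] at this
    rw [← this, mul_assoc, ← exp_add]
    simp
  have hF0M : ‖F 0‖ ≤ M := hM 0 h0U
  have hMpos : 0 < M := by linarith
  have hFpos : 0 < ‖F 0‖ := by linarith
  -- The factor 2 makes the bound for Re g strictly positive even when |F(0)| = M.
  have hm : 0 < Real.log (2 * M / ‖F 0‖) := Real.log_pos (by
    rw [lt_div_iff₀ hFpos]; linarith)
  have hnorm : ∀ x ∈ U, ‖F x‖ = ‖F 0‖ * Real.exp (g x).re := fun x hx => by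
    rw [hconst x hx, norm_mul, norm_exp]
  have hbc := borelCaratheodory_zero (f := g) hm
    (fun x hx => (hg x hx).differentiableAt.differentiableWithinAt)
    (fun x hx => ?_) (by linarith) hzU hg0
  · have hle : ‖g z‖ ≤ 2 * Real.log (2 * M / ‖F 0‖) := by
      refine hbc.trans ?_
      rw [div_le_iff₀ (by linarith)]
      nlinarith
    have hre : -(2 * Real.log (2 * M / ‖F 0‖)) ≤ (g z).re := by
      have := neg_abs_le (g z).re
      have := abs_re_le_norm (g z)
      linarith
    rw [hnorm z hzU]
    have he : Real.exp (-(2 * Real.log (2 * M / ‖F 0‖))) = (‖F 0‖ / (2 * M)) ^ 2 := by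
      rw [Real.exp_neg, two_mul, Real.exp_add, Real.exp_log (by positivity)]
      field_simp
    calc 1 / (4 * M ^ 2) = 1 * (1 / (2 * M)) ^ 2 := by ring
      _ ≤ ‖F 0‖ * (‖F 0‖ / (2 * M)) ^ 2 := by gcongr
      _ ≤ _ := by rw [← he]; gcongr
  · simp only [Set.mem_ofPred_eq]
    rw [Real.le_log_iff_exp_le (by positivity), le_div_iff₀ hFpos, mul_comm, ← hnorm x hx]
    linarith [hM x hx]

/-- The denominator of a Blaschke factor, on the boundary of the disc. -/
theorem norm_sq_sub_conj_mul {R : ℝ} {z ρ : ℂ} (hz : ‖z‖ = R) :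
    ‖(R : ℂ) ^ 2 - (starRingEnd ℂ) ρ * z‖ = R * ‖z - ρ‖ := by
  have h : (R : ℂ) ^ 2 = z * (starRingEnd ℂ) z := by
    rw [mul_conj, normSq_eq_norm_sq, hz]; push_cast; rfl
  rw [h, show z * (starRingEnd ℂ) z - (starRingEnd ℂ) ρ * z = z * (starRingEnd ℂ) (z - ρ) by
    rw [map_sub]; ring, norm_mul, hz, norm_conj]

/-- Division of an entire function by the Blaschke factor of one of its zeros. -/
theorem exists_blaschke_quotient {F : ℂ → ℂ} {r M : ℝ} (hr : 0 < r) (hF : Differentiable ℂ F)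
    (hM : ∀ z ∈ closedBall (0 : ℂ) (4 * r), ‖F z‖ ≤ M) {ρ : ℂ} (hρ : ‖ρ‖ < 2 * r)
    (hFρ : F ρ = 0) :
    ∃ F₁ : ℂ → ℂ, Differentiable ℂ F₁ ∧ (∀ z ∈ closedBall (0 : ℂ) (4 * r), ‖F₁ z‖ ≤ M) ∧
      2 * ‖F 0‖ ≤ ‖F₁ 0‖ ∧ (∀ z, ‖z‖ < 2 * r → F₁ z = 0 → F z = 0) ∧
      ∀ z, ‖z‖ ≤ r → ‖z - ρ‖ / (8 * r) * ‖F₁ z‖ ≤ ‖F z‖ := by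
  set R : ℝ := 4 * r with hR
  have hRpos : 0 < R := by linarith
  set q : ℂ → ℂ := fun z => (R : ℂ) ^ 2 - (starRingEnd ℂ) ρ * z with hq
  -- F(z) / (z - ρ), continued across ρ. The quotient sought is h q / R, and |q| = R |z - ρ| on |z|
  -- = R.
  set h : ℂ → ℂ := dslope F ρ with hh
  have hhd : Differentiable ℂ h := by
    rw [← differentiableOn_univ] at hF ⊢
    exact (differentiableOn_dslope Filter.univ_mem).2 hF
  have hFh : ∀ z, F z = (z - ρ) * h z := fun z => by
    have := sub_smul_dslope F ρ z
    rw [hFρ, sub_zero, smul_eq_mul] at this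
    exact this.symm
  have hF₁ : Differentiable ℂ fun z => h z * q z / R := by
    simp only [hq]; fun_prop
  have hnR : ‖(R : ℂ)‖ = R := by simp [abs_of_pos hRpos]
  refine ⟨fun z => h z * q z / R, hF₁, fun z hz => ?_, ?_, fun z hz hz0 => ?_, fun z hz => ?_⟩
  · refine norm_le_of_forall_mem_frontier_norm_le (U := ball (0 : ℂ) R) isBounded_ball
      hF₁.diffContOnCl (fun x hx => ?_) (by rwa [closure_ball _ hRpos.ne'])
    rw [frontier_ball _ hRpos.ne', mem_sphere_zero_iff_norm] at hx
    have h1 := hM x (by rw [mem_closedBall_zero_iff, hx])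
    rw [hFh, norm_mul] at h1
    rw [norm_div, norm_mul, hnR]
    simp only [hq]
    rw [norm_sq_sub_conj_mul hx]
    calc _ = ‖x - ρ‖ * ‖h x‖ := by field_simp
      _ ≤ M := h1
  · have h1 : ‖F 0‖ = ‖ρ‖ * ‖h 0‖ := by rw [hFh, norm_mul, zero_sub, norm_neg]
    have h2 : ‖h 0 * q 0 / R‖ = ‖h 0‖ * R := by
      simp only [hq, mul_zero, sub_zero, norm_div, norm_mul, norm_pow, hnR]
      field_simp
    rw [h2, h1]
    nlinarith [norm_nonneg (h 0)]
  -- No zero is introduced: |ρ| |z| < 4r² < R².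
  · have hq0 : q z ≠ 0 := by
      intro h0
      have h1 : (R : ℂ) ^ 2 = (starRingEnd ℂ) ρ * z := sub_eq_zero.1 h0
      have h2 := congrArg norm h1
      rw [norm_pow, hnR, norm_mul, norm_conj] at h2
      nlinarith [norm_nonneg ρ, norm_nonneg z]
    have hRc : (R : ℂ) ≠ 0 := by exact_mod_cast hRpos.ne'
    have : h z = 0 := by simpa [hq0, hRc] using hz0
    rw [hFh, this, mul_zero]
  · have h1 : ‖q z‖ ≤ 2 * R ^ 2 := by
      calc ‖q z‖ ≤ ‖(R : ℂ) ^ 2‖ + ‖(starRingEnd ℂ) ρ * z‖ := norm_sub_le _ _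
        _ = R ^ 2 + ‖ρ‖ * ‖z‖ := by rw [norm_pow, hnR, norm_mul, norm_conj]
        _ ≤ R ^ 2 + (2 * r) * r := by gcongr
        _ ≤ 2 * R ^ 2 := by rw [hR]; nlinarith
    rw [hFh, norm_mul, norm_div, norm_mul, hnR]
    calc ‖z - ρ‖ / (8 * r) * (‖h z‖ * ‖q z‖ / R)
        ≤ ‖z - ρ‖ / (8 * r) * (‖h z‖ * (2 * R ^ 2) / R) := by gcongr
      _ = ‖z - ρ‖ * ‖h z‖ := by rw [hR]; field_simp; ring

/-- A lower bound for an entire function in terms of its growth and the distance to its zeros. -/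
theorem norm_lower_bound {r M D : ℝ} (hr : 1 ≤ r) (hD : 0 < D) (hD1 : D ≤ 1) {z : ℂ}
    (hz : ‖z‖ ≤ r) (n : ℕ) : ∀ {F : ℂ → ℂ}, Differentiable ℂ F →
    (∀ w ∈ closedBall (0 : ℂ) (4 * r), ‖F w‖ ≤ M) → 1 ≤ ‖F 0‖ → M ≤ 2 ^ n * ‖F 0‖ →
    (∀ ρ, ‖ρ‖ < 2 * r → F ρ = 0 → D ≤ ‖z - ρ‖) →
    (D / (8 * r)) ^ n / (4 * M ^ 2) ≤ ‖F z‖ := by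
  induction n with
  | zero =>
    intro F hF hM h0 hMn hρ
    rw [pow_zero]
    refine norm_lower_bound_of_ne_zero (r := r) (by linarith) hF.differentiableOn (fun w hw => hM w
      (ball_subset_closedBall.trans (closedBall_subset_closedBall (by linarith)) hw)) h0
      (fun w hw hw0 => ?_) hz
    -- A zero would give a quotient of modulus at least 2|F(0)| at 0, although M ≤ |F(0)|.
    obtain ⟨F₁, -, hb, h2, -⟩ := exists_blaschke_quotient (by linarith) hF hM
      (mem_ball_zero_iff.1 hw) hw0
    have := hb 0 (by simp; linarith)
    linarith
  | succ n ih =>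
    intro F hF hM h0 hMn hρ
    have hb0 : 0 ≤ D / (8 * r) := by positivity
    have hb1 : D / (8 * r) ≤ 1 := by rw [div_le_one (by linarith)]; linarith
    by_cases hne : ∀ w ∈ ball (0 : ℂ) (2 * r), F w ≠ 0
    · refine le_trans ?_ (norm_lower_bound_of_ne_zero (r := r) (by linarith) hF.differentiableOn
        (fun w hw => hM w (ball_subset_closedBall.trans (closedBall_subset_closedBall
          (by linarith)) hw)) h0 hne hz)
      gcongr
      exact pow_le_one₀ hb0 hb1
    · push Not at hne
      obtain ⟨ρ, hρb, hρ0⟩ := hne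
      rw [mem_ball_zero_iff] at hρb
      obtain ⟨F₁, hd, hb, h2, hzero, hlow⟩ := exists_blaschke_quotient (by linarith) hF hM hρb hρ0
      -- Doubling at the centre pays for the lost factor 2 in M ≤ 2^(n+1) |F(0)|.
      have key := ih hd hb (by linarith)
        (by rw [pow_succ] at hMn; have : (0 : ℝ) < 2 ^ n := by positivity
            nlinarith) fun w hw hw0 => hρ w hw (hzero w hw hw0)
      refine le_trans ?_ (hlow z hz)
      calc (D / (8 * r)) ^ (n + 1) / (4 * M ^ 2)
          = D / (8 * r) * ((D / (8 * r)) ^ n / (4 * M ^ 2)) := by ring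
        _ ≤ ‖z - ρ‖ / (8 * r) * ‖F₁ z‖ := by
          gcongr
          exact hρ ρ hρb hρ0

end

/-! ### Polynomial growth on vertical strips -/

namespace LerchZeta

open Complex MeasureTheory Filter Topology

/-- Polynomial growth in `s` on closed vertical strips of the half-plane `τ < Re s`, locally
uniformly in the parameter `a > 0`. -/
def PolynomialGrowth (τ : ℝ) (f : ℝ → ℂ → ℂ) : Prop :=
  ∀ a₀ a₁ σ₀ σ₁ : ℝ, 0 < a₀ → τ < σ₀ → ∃ C : ℝ, 0 ≤ C ∧ ∃ A : ℕ, ∀ a ∈ Set.Icc a₀ a₁,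
    ∀ s : ℂ, s.re ∈ Set.Icc σ₀ σ₁ → ‖f a s‖ ≤ C * (1 + ‖s‖) ^ A

namespace PolynomialGrowth

variable {τ : ℝ} {f g : ℝ → ℂ → ℂ}

theorem add (hf : PolynomialGrowth τ f) (hg : PolynomialGrowth τ g) :
    PolynomialGrowth τ fun a s => f a s + g a s := by
  intro a₀ a₁ σ₀ σ₁ ha hσ
  obtain ⟨C, hC, A, h⟩ := hf a₀ a₁ σ₀ σ₁ ha hσ
  obtain ⟨C', hC', A', h'⟩ := hg a₀ a₁ σ₀ σ₁ ha hσ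
  refine ⟨C + C', by positivity, max A A', fun a haI s hs => ?_⟩
  have h1 : 1 ≤ 1 + ‖s‖ := by linarith [norm_nonneg s]
  calc ‖f a s + g a s‖ ≤ C * (1 + ‖s‖) ^ A + C' * (1 + ‖s‖) ^ A' :=
        (norm_add_le _ _).trans (add_le_add (h a haI s hs) (h' a haI s hs))
    _ ≤ C * (1 + ‖s‖) ^ max A A' + C' * (1 + ‖s‖) ^ max A A' := by
        gcongr
        exacts [le_max_left _ _, le_max_right _ _]
    _ = _ := by ring

theorem mul (hf : PolynomialGrowth τ f) (hg : PolynomialGrowth τ g) :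
    PolynomialGrowth τ fun a s => f a s * g a s := by
  intro a₀ a₁ σ₀ σ₁ ha hσ
  obtain ⟨C, hC, A, h⟩ := hf a₀ a₁ σ₀ σ₁ ha hσ
  obtain ⟨C', hC', A', h'⟩ := hg a₀ a₁ σ₀ σ₁ ha hσ
  refine ⟨C * C', by positivity, A + A', fun a haI s hs => ?_⟩
  calc ‖f a s * g a s‖ ≤ (C * (1 + ‖s‖) ^ A) * (C' * (1 + ‖s‖) ^ A') := by
        rw [norm_mul]
        exact mul_le_mul (h a haI s hs) (h' a haI s hs) (norm_nonneg _) (by positivity)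
    _ = _ := by ring

theorem const (τ : ℝ) (c : ℂ) : PolynomialGrowth τ fun _ _ => c := by
  intro a₀ a₁ σ₀ σ₁ _ _
  exact ⟨‖c‖, norm_nonneg _, 0, fun a _ s _ => by simp⟩

theorem id (τ : ℝ) : PolynomialGrowth τ fun _ s => s := by
  intro a₀ a₁ σ₀ σ₁ _ _
  exact ⟨1, zero_le_one, 1, fun a _ s _ => by simp⟩

theorem cpow (τ c : ℝ) : PolynomialGrowth τ fun a s => (a : ℂ) ^ (c - s) := by
  intro a₀ a₁ σ₀ σ₁ ha _
  have hcont : ContinuousOn (fun p : ℝ × ℝ => p.1 ^ (c - p.2))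
      (Set.Icc a₀ a₁ ×ˢ Set.Icc σ₀ σ₁) := by
    rintro ⟨a, σ⟩ ⟨h, -⟩
    exact ((continuousAt_fst).rpow (by fun_prop)
      (Or.inl (ha.trans_le h.1).ne')).continuousWithinAt
  obtain ⟨C, hC⟩ := (isCompact_Icc.prod isCompact_Icc).exists_bound_of_continuousOn hcont
  refine ⟨max C 0, le_max_right _ _, 0, fun a haI s hs => ?_⟩
  have := hC (a, s.re) ⟨haI, hs⟩
  have h0 : 0 < a := ha.trans_le haI.1
  rw [norm_cpow_eq_rpow_re_of_pos h0, pow_zero, mul_one, sub_re, ofReal_re]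
  refine le_trans ?_ (this.trans (le_max_left _ _))
  exact le_abs_self _

/-- The inductive step for both recursions, gaining a unit strip on the left. The shift of a by u is
the reason why growth is required uniformly in the parameter. -/
theorem integral (hf : PolynomialGrowth τ f) {ψ : ℝ → ℂ}
    (hψ : ∀ u ∈ Set.Icc (0 : ℝ) 1, ‖ψ u‖ ≤ 1) :
    PolynomialGrowth (τ - 1) fun a s => ∫ u in (0 : ℝ)..1, ψ u * f (a + |u|) (s + 1) := by
  intro a₀ a₁ σ₀ σ₁ ha hσ
  obtain ⟨C, hC, A, h⟩ := hf a₀ (a₁ + 1) (σ₀ + 1) (σ₁ + 1) ha (by linarith)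
  refine ⟨C * 2 ^ A, by positivity, A, fun a haI s hs => ?_⟩
  have := intervalIntegral.norm_integral_le_of_norm_le_const (a := (0 : ℝ)) (b := 1)
    (f := fun u => ψ u * f (a + |u|) (s + 1)) (C := C * 2 ^ A * (1 + ‖s‖) ^ A) fun u hu => ?_
  · simpa using this
  · rw [Set.uIoc_of_le zero_le_one] at hu
    have h1 := h (a + |u|) ⟨by linarith [haI.1, abs_nonneg u], by
      rw [abs_of_pos hu.1]; linarith [haI.2, hu.2]⟩ (s + 1)
      ⟨by simp; linarith [hs.1], by simp; linarith [hs.2]⟩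
    have h2 : 1 + ‖s + 1‖ ≤ 2 * (1 + ‖s‖) := by
      have := norm_add_le s 1
      rw [norm_one] at this
      linarith [norm_nonneg s]
    calc ‖ψ u * f (a + |u|) (s + 1)‖ ≤ 1 * (C * (1 + ‖s + 1‖) ^ A) := by
          rw [norm_mul]
          exact mul_le_mul (hψ u ⟨hu.1.le, hu.2⟩) h1 (norm_nonneg _) zero_le_one
      _ ≤ 1 * (C * (2 * (1 + ‖s‖)) ^ A) := by gcongr
      _ = _ := by rw [mul_pow]; ring

end PolynomialGrowth

theorem polynomialGrowth_aux {w : ℂ} (hw : ‖w‖ = 1) (k : ℕ) :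
    PolynomialGrowth (1 - k) (aux w k) := by
  induction k with
  | zero =>
    have h1 : PolynomialGrowth (1 - (0 : ℕ)) fun a s => (a : ℂ) ^ (-s) := by
      simpa using PolynomialGrowth.cpow (1 - (0 : ℕ)) 0
    refine h1.add fun a₀ a₁ σ₀ σ₁ ha hσ => ?_
    simp only [Nat.cast_zero, sub_zero] at hσ
    refine ⟨∑' m : ℕ, 1 / ((m + 1 : ℕ) : ℝ) ^ σ₀, tsum_nonneg fun m => by positivity, 0,
      fun a haI s hs => ?_⟩
    rw [pow_zero, mul_one]
    exact tsum_of_norm_bounded (bound_summable hσ).hasSum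
      fun m => term_bound hw (ha.trans_le haI.1) (by linarith) hs.1 m
  | succ k ih =>
    have h1 : PolynomialGrowth (1 - (k + 1 : ℕ)) fun a s => (a : ℂ) ^ (-s) := by
      simpa using PolynomialGrowth.cpow (1 - (k + 1 : ℕ)) 0
    have h2 := ih.integral (ψ := fun _ => 1) (by simp)
    rw [show (1 : ℝ) - k - 1 = 1 - (k + 1 : ℕ) by push_cast; ring] at h2
    -- For w = 1 the inverse is 0 by convention and the bound is still true; only k = 0 is used with
    -- w = 1.
    have h3 := (h1.add ((((PolynomialGrowth.id _).mul (.const _ (-w)))).mul h2)).mul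
      (.const _ (1 - w)⁻¹)
    convert h3 using 3 with a s
    simp only [aux, one_mul]
    ring

/-! ### The Hurwitz case λ = 1 -/

/-- Continuations of `(s - 1) ζ(s, a)` to `Re s > 1 - k`, from the identity
`(s - 1) ζ(s, a) = a ^ (1 - s) + (s - 1) ∫ u in 0..1, (1 - u) s ζ(s + 1, a + u)`. -/
noncomputable def hurwitzAux : ℕ → ℝ → ℂ → ℂ
  | 0, a, s => (s - 1) * aux 1 0 a s
  | k + 1, a, s => (a : ℂ) ^ (1 - s) +
      (s - 1) * ∫ u in (0 : ℝ)..1, ((1 - u : ℝ) : ℂ) * hurwitzAux k (a + |u|) (s + 1)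

theorem polynomialGrowth_hurwitzAux (k : ℕ) : PolynomialGrowth (1 - k) (hurwitzAux k) := by
  have hsub : ∀ τ, PolynomialGrowth τ fun _ s => s - 1 := fun τ => by
    simpa [sub_eq_add_neg] using (PolynomialGrowth.id τ).add (.const τ (-1))
  induction k with
  | zero => exact (hsub _).mul (polynomialGrowth_aux norm_one 0)
  | succ k ih =>
    have h2 := ih.integral (ψ := fun u => ((1 - u : ℝ) : ℂ)) fun u hu => by
      rw [norm_real, Real.norm_of_nonneg (by linarith [hu.2])]
      linarith [hu.1]
    rw [show (1 : ℝ) - k - 1 = 1 - (k + 1 : ℕ) by push_cast; ring] at h2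
    have h1 := PolynomialGrowth.cpow (1 - (k + 1 : ℕ)) 1
    simp only [ofReal_one] at h1
    exact h1.add ((hsub _).mul h2)

theorem hurwitzAux_props (k : ℕ) :
    ContinuousOn (fun p : ℝ × ℂ => hurwitzAux k p.1 p.2) {p | 0 < p.1 ∧ 1 - (k : ℝ) < p.2.re} ∧
    ∀ a : ℝ, 0 < a → DifferentiableOn ℂ (hurwitzAux k a) {s | 1 - (k : ℝ) < s.re} := by
  induction k with
  | zero =>
    obtain ⟨hc, hd⟩ := aux_props (w := 1) norm_one 0
    exact ⟨ContinuousOn.mul (by fun_prop) hc,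
      fun a ha => DifferentiableOn.mul (by fun_prop) (hd a ha)⟩
  | succ k ih =>
    obtain ⟨ihc, ihd⟩ := ih
    constructor
    · refine ContinuousOn.add ?_ (ContinuousOn.mul (by fun_prop) ?_)
      · rintro ⟨a, s⟩ ⟨ha, -⟩
        refine (ContinuousAt.cpow (by fun_prop) (by fun_prop) (Or.inl ?_)).continuousWithinAt
        simpa using ha
      · rw [continuousOn_iff_continuous_domRestrict]
        refine intervalIntegral.continuous_parametric_intervalIntegral_of_continuous'
          (f := fun (p : {p : ℝ × ℂ | 0 < p.1 ∧ 1 - ((k + 1 : ℕ) : ℝ) < p.2.re}) (u : ℝ) =>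
            ((1 - u : ℝ) : ℂ) * hurwitzAux k (p.1.1 + |u|) (p.1.2 + 1)) ?_ 0 1
        refine Continuous.mul (by fun_prop) (ihc.comp_continuous
          (f := fun q : {p : ℝ × ℂ | 0 < p.1 ∧ 1 - ((k + 1 : ℕ) : ℝ) < p.2.re} × ℝ =>
            (q.1.1.1 + |q.2|, q.1.1.2 + 1)) (by fun_prop) ?_)
        rintro ⟨⟨⟨a, s⟩, ha, hs⟩, u⟩
        simp only [Nat.cast_add, Nat.cast_one] at ha hs
        refine ⟨by positivity, ?_⟩
        simp only [add_re, one_re]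
        linarith
    · intro a ha
      have hop : IsOpen {z : ℂ | 1 - ((k + 1 : ℕ) : ℝ) < z.re} :=
        isOpen_lt continuous_const continuous_re
      have hmaps : Set.MapsTo (fun z : ℂ => z + 1) {z : ℂ | 1 - ((k + 1 : ℕ) : ℝ) < z.re}
          {z : ℂ | 1 - (k : ℝ) < z.re} := by
        intro z hz
        simp only [Nat.cast_add, Nat.cast_one, Set.mem_ofPred_eq, add_re, one_re] at hz ⊢
        linarith
      have hpow : Differentiable ℂ fun s : ℂ => (a : ℂ) ^ (1 - s) :=
        (by fun_prop : Differentiable ℂ fun s : ℂ => 1 - s).const_cpow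
          (Or.inl (by exact_mod_cast ha.ne'))
      refine hpow.differentiableOn.add (DifferentiableOn.mul (by fun_prop) ?_)
      refine differentiableOn_integral
        (g := fun u s => ((1 - u : ℝ) : ℂ) * hurwitzAux k (a + |u|) (s + 1)) hop ?_ ?_
      · refine ContinuousOn.mul (by fun_prop) (ihc.comp
          (f := fun q : ℝ × ℂ => (a + |q.1|, q.2 + 1)) (Continuous.continuousOn (by fun_prop)) ?_)
        rintro ⟨u, z⟩ ⟨-, hz⟩
        exact ⟨by positivity, hmaps hz⟩
      · intro u
        exact ((ihd (a + |u|) (by positivity)).comp (by fun_prop) hmaps).const_mul _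

/-- Taylor's formula with integral remainder for f(x) = x^(1-s): f(b+1) = f(b) + f'(b) + ∫ (1-u)
f''(b+u) du. -/
theorem integral_weighted_term {b : ℝ} (hb : 0 < b) (s : ℂ) :
    (s - 1) * s * ∫ u in (0 : ℝ)..1, ((1 - u : ℝ) : ℂ) * ((b : ℂ) + (|u| : ℝ)) ^ (-(s + 1)) =
      (s - 1) * (b : ℂ) ^ (-s) + (((b : ℂ) + 1) ^ (1 - s) - (b : ℂ) ^ (1 - s)) := by
  have hpow : ∀ (c : ℂ) (u : ℝ), u ∈ Set.uIcc (0 : ℝ) 1 →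
      HasDerivAt (fun u : ℝ => ((b : ℂ) + u) ^ c) (c * ((b : ℂ) + u) ^ (c - 1)) u := by
    intro c u hu
    rw [Set.uIcc_of_le zero_le_one] at hu
    have h1 : HasDerivAt (fun z : ℂ => (b : ℂ) + z) 1 (u : ℂ) := (hasDerivAt_id _).const_add _
    have h2 := h1.cpow_const (c := c) (Or.inl (by
      rw [← ofReal_add, ofReal_re]
      linarith [hu.1]))
    simpa using h2.comp_ofReal
  have hderiv : ∀ u ∈ Set.uIcc (0 : ℝ) 1, HasDerivAt
      (fun u : ℝ => -(s - 1) * (1 - (u : ℂ)) * ((b : ℂ) + u) ^ (-s) + ((b : ℂ) + u) ^ (1 - s))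
      ((s - 1) * s * (((1 - u : ℝ) : ℂ) * ((b : ℂ) + (|u| : ℝ)) ^ (-(s + 1)))) u := by
    intro u hu
    have hlin : HasDerivAt (fun u : ℝ => -(s - 1) * (1 - (u : ℂ))) (s - 1) u := by
      simpa using ((HasDerivAt.ofReal_comp (hasDerivAt_id u)).const_sub (1 : ℂ)).const_mul (-(s - 1))
    refine ((hlin.mul (hpow (-s) u hu)).add (hpow (1 - s) u hu)).congr_deriv ?_
    rw [Set.uIcc_of_le zero_le_one] at hu
    rw [abs_of_nonneg hu.1, show -s - 1 = -(s + 1) by ring, show 1 - s - 1 = -s by ring]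
    push_cast
    ring
  rw [← intervalIntegral.integral_const_mul, intervalIntegral.integral_eq_sub_of_hasDerivAt hderiv]
  · simp; ring
  · refine Continuous.intervalIntegrable (continuous_const.mul (Continuous.mul (by fun_prop)
      (Continuous.cpow (by fun_prop) (by fun_prop) fun u => Or.inl ?_))) _ _
    rw [← ofReal_add, ofReal_re]
    positivity

/-- Taylor's formula summed over b = m + a: the differences of (m + a)^(1-s) telescope to -a^(1-s),
as these powers tend to 0 for Re s > 1. The factor s + 1 - 1 is left unsimplified to match
`hurwitzAux` at s + 1. -/
theorem hurwitzAux_one_eq {a : ℝ} (ha : 0 < a) {s : ℂ} (hs : 1 < s.re) :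
    (a : ℂ) ^ (1 - s) + (s - 1) * ∫ u in (0 : ℝ)..1,
      ((1 - u : ℝ) : ℂ) * ((s + 1 - 1) * aux 1 0 (a + |u|) (s + 1)) = (s - 1) * aux 1 0 a s := by
  have hs1 : 1 < (s + 1).re := by simp; linarith
  have hint : HasSum (fun m : ℕ => ∫ u in (0 : ℝ)..1,
      ((1 - u : ℝ) : ℂ) * (((m : ℝ) + a : ℝ) + (|u| : ℝ) : ℂ) ^ (-(s + 1)))
      (∫ u in (0 : ℝ)..1, ((1 - u : ℝ) : ℂ) * aux 1 0 (a + |u|) (s + 1)) := by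
    have hcont : ∀ m : ℕ, Continuous fun u : ℝ =>
        ((1 - u : ℝ) : ℂ) * (((m : ℝ) + a : ℝ) + (|u| : ℝ) : ℂ) ^ (-(s + 1)) := fun m => by
      refine Continuous.mul (by fun_prop) (Continuous.cpow (by fun_prop) (by fun_prop)
        fun u => Or.inl ?_)
      rw [← ofReal_add, ofReal_re]
      positivity
    refine intervalIntegral.hasSum_integral_of_dominated_convergence
      (bound := fun m _ => ((m : ℝ) + a) ^ (-(s + 1).re)) (fun m => (hcont m).aestronglyMeasurable)
      (fun m => Eventually.of_forall fun u hu => ?_) (Eventually.of_forall fun u _ => ?_)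
      intervalIntegrable_const (Eventually.of_forall fun u _ => ?_)
    · rw [Set.uIoc_of_le zero_le_one] at hu
      have h0 : (0 : ℝ) < (m : ℝ) + a := by positivity
      have hu' := abs_nonneg u
      rw [norm_mul, norm_real, Real.norm_of_nonneg (by linarith [hu.2]), ← ofReal_add,
        norm_cpow_eq_rpow_re_of_pos (by positivity), neg_re]
      calc (1 - u) * ((m : ℝ) + a + |u|) ^ (-(s + 1).re)
          ≤ 1 * ((m : ℝ) + a + |u|) ^ (-(s + 1).re) := by gcongr; linarith [hu.1]
        _ ≤ 1 * ((m : ℝ) + a) ^ (-(s + 1).re) := by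
          gcongr ?_ * ?_
          exact Real.rpow_le_rpow_of_nonpos h0 (by linarith) (by linarith)
        _ = _ := one_mul _
    · refine (hasSum_aux_zero (w := 1) norm_one ha hs1).summable.norm.congr fun m => ?_
      have h0 : (0 : ℝ) < (m : ℝ) + a := by positivity
      rw [one_pow, one_mul, show (m : ℂ) + a = (((m : ℝ) + a : ℝ) : ℂ) by push_cast; ring,
        norm_cpow_eq_rpow_re_of_pos h0, neg_re]
    · refine ((hasSum_aux_zero (w := 1) norm_one (a := a + |u|) (by positivity) hs1).mul_left
        ((1 - u : ℝ) : ℂ)).congr_fun fun m => ?_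
      rw [one_pow, one_mul]
      congr 2
      push_cast
      ring
  have hA := hasSum_aux_zero (w := 1) norm_one ha hs
  have hB : HasSum (fun m : ℕ => (((m + 1 : ℕ) : ℂ) + a) ^ (1 - s) - ((m : ℂ) + a) ^ (1 - s))
      ((s - 1) * s * (∫ u in (0 : ℝ)..1, ((1 - u : ℝ) : ℂ) * aux 1 0 (a + |u|) (s + 1)) -
        (s - 1) * aux 1 0 a s) := by
    refine ((hint.mul_left ((s - 1) * s)).sub (hA.mul_left (s - 1))).congr_fun fun m => ?_
    have := integral_weighted_term (b := (m : ℝ) + a) (by positivity) s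
    rw [this]
    push_cast
    rw [show (m : ℂ) + a + 1 = m + 1 + a by ring]
    ring
  have hlim : Tendsto (fun m : ℕ => ((m : ℂ) + a) ^ (1 - s)) atTop (𝓝 0) := by
    rw [tendsto_zero_iff_norm_tendsto_zero]
    have h1 : Tendsto (fun m : ℕ => (m : ℝ) + a) atTop atTop :=
      tendsto_atTop_add_const_right _ _ tendsto_natCast_atTop_atTop
    refine ((tendsto_rpow_neg_atTop (y := s.re - 1) (by linarith)).comp h1).congr fun m => ?_
    have h0 : (0 : ℝ) < (m : ℝ) + a := by positivity
    rw [show (m : ℂ) + a = (((m : ℝ) + a : ℝ) : ℂ) by push_cast; ring,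
      norm_cpow_eq_rpow_re_of_pos h0]
    simp
  have hC := hB.tendsto_sum_nat
  simp only [Finset.sum_range_sub (fun m : ℕ => ((m : ℂ) + a) ^ (1 - s))] at hC
  have hD := tendsto_nhds_unique hC (hlim.sub_const _)
  simp only [Nat.cast_zero, zero_add, zero_sub] at hD
  have hE : ∫ u in (0 : ℝ)..1, ((1 - u : ℝ) : ℂ) * ((s + 1 - 1) * aux 1 0 (a + |u|) (s + 1)) =
      s * ∫ u in (0 : ℝ)..1, ((1 - u : ℝ) : ℂ) * aux 1 0 (a + |u|) (s + 1) := by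
    rw [← intervalIntegral.integral_const_mul]
    congr 1
    ext u
    ring
  rw [hE]
  linear_combination hD

/-- Agreement on Re s > 1 is enough, since the identity theorem propagates it in `exists_entire`. -/
theorem hurwitzAux_eq (k : ℕ) : ∀ {a : ℝ}, 0 < a → ∀ {s : ℂ}, 1 < s.re →
    hurwitzAux k a s = (s - 1) * aux 1 0 a s := by
  induction k with
  | zero => intro a _ s _; rfl
  | succ k ih =>
    intro a ha s hs
    rw [← hurwitzAux_one_eq ha hs, hurwitzAux]
    congr 2
    refine intervalIntegral.integral_congr fun u _ => ?_
    rw [ih (a := a + |u|) (by positivity) (s := s + 1) (by simp; linarith)]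

theorem norm_exp_two_pi_I_mul (lam : ℝ) : ‖cexp (2 * Real.pi * I * lam)‖ = 1 := by
  rw [show (2 * Real.pi * I * lam : ℂ) = ((2 * Real.pi * lam : ℝ) : ℂ) * I by
    push_cast; ring, norm_exp_ofReal_mul_I]

theorem exp_two_pi_I_mul_ne_one {lam : ℝ} (hlam : 0 < lam) (hlt : lam < 1) :
    cexp (2 * Real.pi * I * lam) ≠ 1 := by
  intro h
  obtain ⟨n, hn⟩ := exp_eq_one_iff.1 h
  have h2 : (lam : ℂ) = n := mul_left_cancel₀ two_pi_I_ne_zero (by rw [hn]; ring)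
  have h3 : lam = n := by exact_mod_cast h2
  rw [h3] at hlam hlt
  have h4 : (0 : ℤ) < n := by exact_mod_cast hlam
  have h5 : n < (1 : ℤ) := by exact_mod_cast hlt
  omega

/-! ### The entire function (s - 1) L and the region Re s ≥ 3 -/

section

variable {lam α : ℝ} (hlam : 0 < lam) (hlam1 : lam ≤ 1) (hα : 0 < α) (hα1 : α ≤ 1)
include hlam hlam1 hα hα1

theorem lerchZeta_eq_aux {s : ℂ} (hs : 1 < s.re) :
    lerchZeta lam α s = aux (cexp (2 * Real.pi * I * lam)) 0 α s := by
  refine ((lerchZeta_isContinuation hlam hlam1 hα hα1).hasSum s hs).unique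
    ((hasSum_aux_zero (norm_exp_two_pi_I_mul lam) hα hs).congr_fun fun m => ?_)
  rw [cpow_neg, div_eq_mul_inv, ← Complex.exp_nat_mul]
  congr 2
  ring

/-- The factor s - 1 is kept also when there is no pole, so that both cases yield the same kind of
function. -/
theorem exists_halfPlane_continuation (k : ℕ) : ∃ g : ℂ → ℂ,
    DifferentiableOn ℂ g {s | 1 - (k : ℝ) < s.re} ∧
    (∀ s : ℂ, 1 < s.re → g s = (s - 1) * lerchZeta lam α s) ∧
    ∀ σ₀ σ₁ : ℝ, 1 - (k : ℝ) < σ₀ → ∃ C : ℝ, 0 ≤ C ∧ ∃ A : ℕ, ∀ s : ℂ,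
      s.re ∈ Set.Icc σ₀ σ₁ → ‖g s‖ ≤ C * (1 + ‖s‖) ^ A := by
  have key : ∀ f : ℝ → ℂ → ℂ, PolynomialGrowth (1 - k) f →
      ∀ σ₀ σ₁ : ℝ, 1 - (k : ℝ) < σ₀ → ∃ C : ℝ, 0 ≤ C ∧ ∃ A : ℕ, ∀ s : ℂ,
      s.re ∈ Set.Icc σ₀ σ₁ → ‖f α s‖ ≤ C * (1 + ‖s‖) ^ A := fun f hf σ₀ σ₁ hσ => by
    obtain ⟨C, hC, A, h⟩ := hf α α σ₀ σ₁ hα hσ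
    exact ⟨C, hC, A, h α (by simp)⟩
  rcases hlam1.eq_or_lt with rfl | hlt
  · refine ⟨hurwitzAux k α, (hurwitzAux_props k).2 α hα, fun s hs => ?_,
      key _ (polynomialGrowth_hurwitzAux k)⟩
    rw [hurwitzAux_eq k hα hs, lerchZeta_eq_aux hlam hlam1 hα hα1 hs]
    simp [exp_two_pi_mul_I]
  · have hw := norm_exp_two_pi_I_mul lam
    refine ⟨fun s => (s - 1) * aux (cexp (2 * Real.pi * I * lam)) k α s,
      DifferentiableOn.mul (by fun_prop) ((aux_props hw k).2 α hα), fun s hs => ?_,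
      key (fun a s => (s - 1) * aux (cexp (2 * Real.pi * I * lam)) k a s)
        (PolynomialGrowth.mul ?_ (polynomialGrowth_aux hw k))⟩
    · simp only
      rw [lerchZeta_eq_aux hlam hlam1 hα hα1 hs, aux_eq_of_le hw
        (exp_two_pi_I_mul_ne_one hlam hlt) hα k.zero_le (by simpa using hs)]
    · simpa [sub_eq_add_neg] using (PolynomialGrowth.id (1 - k)).add (.const _ (-1))

/-- `(s - 1) L(lam, α, s)` extends to an entire function of polynomial growth on vertical strips. -/
theorem exists_entire : ∃ G : ℂ → ℂ, Differentiable ℂ G ∧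
    (∀ s : ℂ, s ≠ 1 → G s = (s - 1) * lerchZeta lam α s) ∧
    ∀ σ₀ σ₁ : ℝ, ∃ C : ℝ, 0 ≤ C ∧ ∃ A : ℕ, ∀ s : ℂ,
      s.re ∈ Set.Icc σ₀ σ₁ → ‖G s‖ ≤ C * (1 + ‖s‖) ^ A := by
  choose g hgd hgL hgb using exists_halfPlane_continuation hlam hlam1 hα hα1
  have hop : ∀ τ : ℝ, IsOpen {s : ℂ | τ < s.re} := fun τ =>
    isOpen_lt continuous_const continuous_re
  have hmono : ∀ {k l : ℕ}, k ≤ l → ∀ s : ℂ, 1 - (k : ℝ) < s.re → g l s = g k s := by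
    intro k l hkl s hs
    have hkl' : (k : ℝ) ≤ l := by exact_mod_cast hkl
    have h2 : (2 : ℂ) ∈ {s : ℂ | 1 - (k : ℝ) < s.re} := by
      have : (0 : ℝ) ≤ k := k.cast_nonneg
      simp only [Set.mem_ofPred_eq, re_ofNat]
      linarith
    refine (((hgd l).mono fun z (hz : 1 - (k : ℝ) < z.re) => ?_).analyticOnNhd
      (hop _)).eqOn_of_preconnected_of_eventuallyEq ((hgd k).analyticOnNhd (hop _))
      (convex_halfSpace_re_gt _).isPreconnected h2 ?_ hs
    · simp only [Set.mem_ofPred_eq]; linarith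
    · filter_upwards [(hop 1).mem_nhds (show (2 : ℂ) ∈ {z : ℂ | 1 < z.re} by simp)] with z hz
      rw [hgL l z hz, hgL k z hz]
  -- The index ⌊|σ|⌋ + 2 is one admissible k; by `hmono` every k with 1 - k < σ gives the same
  -- value.
  set G : ℂ → ℂ := fun s => g (⌊|s.re|⌋₊ + 2) s with hG
  have hGk : ∀ (k : ℕ) (s : ℂ), 1 - (k : ℝ) < s.re → G s = g k s := by
    intro k s hs
    have h1 : 1 - ((⌊|s.re|⌋₊ + 2 : ℕ) : ℝ) < s.re := by
      have := Nat.lt_floor_add_one |s.re|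
      have := neg_abs_le s.re
      push_cast
      linarith
    rcases le_total k (⌊|s.re|⌋₊ + 2) with h | h
    · exact hmono h s hs
    · exact (hmono h s h1).symm
  have hGd : Differentiable ℂ G := fun s => by
    obtain ⟨k, hk⟩ := exists_nat_gt (1 - s.re)
    have hsm : s ∈ {z : ℂ | 1 - (k : ℝ) < z.re} := by
      simp only [Set.mem_ofPred_eq]; linarith
    refine ((hgd k).differentiableAt ((hop _).mem_nhds hsm)).congr_of_eventuallyEq ?_
    filter_upwards [(hop _).mem_nhds hsm] with z hz using hGk k z hz
  refine ⟨G, hGd, fun s hs => ?_, fun σ₀ σ₁ => ?_⟩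
  · have hL : DifferentiableOn ℂ (fun s => (s - 1) * lerchZeta lam α s) {1}ᶜ :=
      DifferentiableOn.mul (by fun_prop)
        ((lerchZeta_isContinuation hlam hlam1 hα hα1).differentiableOn.mono fun z hz _ => hz)
    refine (hGd.differentiableOn.analyticOnNhd
      isOpen_compl_singleton).eqOn_of_preconnected_of_eventuallyEq
      (hL.analyticOnNhd isOpen_compl_singleton)
      (isConnected_compl_singleton_of_one_lt_rank
        (by rw [Complex.rank_real_complex]; norm_num) 1).isPreconnected
      (show (2 : ℂ) ∈ ({1}ᶜ : Set ℂ) by simp) ?_ hs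
    filter_upwards [(hop 1).mem_nhds (show (2 : ℂ) ∈ {z : ℂ | 1 < z.re} by simp)] with z hz
    rw [hGk 0 z (by simpa using hz), hgL 0 z hz]
  · obtain ⟨k, hk⟩ := exists_nat_gt (1 - σ₀)
    obtain ⟨C, hC, A, h⟩ := hgb k σ₀ σ₁ (by linarith)
    refine ⟨C, hC, A, fun s hs => ?_⟩
    rw [hGk k s (by linarith [hs.1])]
    exact h s hs

/-- In `3 ≤ Re s` the first term of the Dirichlet series dominates. -/
theorem half_le_norm_lerchZeta {s : ℂ} (hs : 3 ≤ s.re) : 1 / 2 ≤ ‖lerchZeta lam α s‖ := by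
  have h1 := (lerchZeta_isContinuation hlam hlam1 hα hα1).hasSum s (by linarith)
  have hnorm : ∀ m : ℕ, ‖cexp (2 * Real.pi * I * lam * m) / ((m : ℂ) + α) ^ s‖ =
      ((m : ℝ) + α) ^ (-s.re) := fun m => by
    have h0 : (0 : ℝ) < (m : ℝ) + α := by positivity
    rw [norm_div, show (2 * Real.pi * I * lam * m : ℂ) = ((2 * Real.pi * lam * m : ℝ) : ℂ) * I by
      push_cast; ring, norm_exp_ofReal_mul_I, show (m : ℂ) + α = (((m : ℝ) + α : ℝ) : ℂ) by
      push_cast; ring, norm_cpow_eq_rpow_re_of_pos h0, Real.rpow_neg h0.le, one_div]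
  have h2 := (hasSum_nat_add_iff' 1).2 h1
  have hz : HasSum (fun m : ℕ => 1 / ((m + 1 + 1 : ℕ) : ℝ) ^ 2) (Real.pi ^ 2 / 6 - 1) := by
    have := (hasSum_nat_add_iff' 2).2 hasSum_zeta_two
    simpa [Finset.sum_range_succ, add_assoc, one_add_one_eq_two] using this
  have hpi : Real.pi ^ 2 / 6 - 1 ≤ 1 := by nlinarith [Real.pi_lt_d2, Real.pi_pos]
  have htail := h2.norm_le_of_bounded (hz.mul_left (α ^ (-s.re) / 2)) fun m => by
    rw [hnorm]
    have hm : (0 : ℝ) ≤ m := m.cast_nonneg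
    -- Uses α ≤ 1. It extracts α^(-σ) from the tail, which is then at most half the first term,
    -- uniformly in σ.
    have h3 : α * ((m : ℝ) + 2) ≤ ((m + 1 : ℕ) : ℝ) + α := by push_cast; nlinarith
    have h4 : ((m : ℝ) + 2) ^ (-s.re) ≤ ((m : ℝ) + 2) ^ (-(3 : ℝ)) :=
      Real.rpow_le_rpow_of_exponent_le (by linarith) (by linarith)
    have h5 : ((m : ℝ) + 2) ^ (-(3 : ℝ)) ≤ 1 / 2 * (1 / ((m + 1 + 1 : ℕ) : ℝ) ^ 2) := by
      rw [Real.rpow_neg (by linarith), show (3 : ℝ) = ((3 : ℕ) : ℝ) by norm_num, Real.rpow_natCast,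
        show ((m + 1 + 1 : ℕ) : ℝ) = (m : ℝ) + 2 by push_cast; ring, ← one_div, div_mul_div_comm,
        one_mul]
      gcongr
      nlinarith [sq_nonneg ((m : ℝ) + 2)]
    calc (((m + 1 : ℕ) : ℝ) + α) ^ (-s.re) ≤ (α * ((m : ℝ) + 2)) ^ (-s.re) :=
          Real.rpow_le_rpow_of_nonpos (by positivity) h3 (by linarith)
      _ = α ^ (-s.re) * ((m : ℝ) + 2) ^ (-s.re) := Real.mul_rpow hα.le (by linarith)
      _ ≤ α ^ (-s.re) * (1 / 2 * (1 / ((m + 1 + 1 : ℕ) : ℝ) ^ 2)) := by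
          gcongr
          exact h4.trans h5
      _ = _ := by ring
  have hα0 : 1 ≤ α ^ (-s.re) := Real.one_le_rpow_of_pos_of_le_one_of_nonpos hα hα1 (by linarith)
  have hfirst := hnorm 0
  simp only [Finset.sum_range_one] at htail
  have h6 := norm_sub_norm_le (cexp (2 * Real.pi * I * lam * (0 : ℕ)) / (((0 : ℕ) : ℂ) + α) ^ s)
    (lerchZeta lam α s)
  rw [norm_sub_rev] at h6
  have h7 : α ^ (-s.re) / 2 * (Real.pi ^ 2 / 6 - 1) ≤ α ^ (-s.re) / 2 * 1 := by gcongr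
  simp only [Nat.cast_zero, zero_add] at hfirst h6 htail
  linarith

end

/-! ### From the zeros to the lower bound for L -/

/-- A point that is neither a zero nor the pole has positive distance from the zeros. -/
theorem infDist_lerchZeros_pos {lam α : ℝ} (hlam : 0 < lam) (hlam1 : lam ≤ 1) (hα : 0 < α)
    (hα1 : α ≤ 1) {s : ℂ} (hs1 : s ≠ 1) (hs : lerchZeta lam α s ≠ 0)
    (hne : (lerchZeros lam α).Nonempty) : 0 < Metric.infDist s (lerchZeros lam α) := by
  have hcont : ContinuousAt (lerchZeta lam α) s :=
    (((lerchZeta_isContinuation hlam hlam1 hα hα1).differentiableOn.mono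
      fun z (hz : z ∈ ({1}ᶜ : Set ℂ)) _ => hz).differentiableAt
      (isOpen_compl_singleton.mem_nhds hs1)).continuousAt
  rw [← Metric.infDist_closure, ← isClosed_closure.notMem_iff_infDist_pos hne.closure]
  intro hmem
  obtain ⟨ρ, h1, h2⟩ := mem_closure_iff_nhds.1 hmem _ (hcont.eventually_ne hs)
  exact h1 h2.2

end LerchZeta

-- `norm_lower_bound` for w ↦ G(p + w) with p = 3 + it and M = t^B. The factor M on the right
-- absorbs |s - 1|. A free D instead of the distance also covers an empty set of zeros.
open Complex in
theorem LerchZeta.norm_lower_bound_of_re_le_three {lam α : ℝ} (hlam : 0 < lam) (hlam1 : lam ≤ 1)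
    (hα : 0 < α) (hα1 : α ≤ 1) (σ₀ : ℝ) :
    ∃ B r : ℝ, 0 ≤ B ∧ 1 ≤ r ∧ ∀ s : ℂ, σ₀ ≤ s.re → s.re ≤ 3 → 2 ≤ s.im → ∀ D : ℝ, 0 < D →
      D ≤ 1 → (∀ ρ ∈ lerchZeros lam α, D ≤ ‖s - ρ‖) → ∃ n : ℕ, n ≤ (B + 1) * (2 * Real.log s.im) ∧
      (D / (8 * r)) ^ n / (4 * Real.exp (B * Real.log s.im) ^ 2) ≤
        Real.exp (B * Real.log s.im) * ‖lerchZeta lam α s‖ := by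
  obtain ⟨G, hGd, hGL, hGb⟩ := exists_entire hlam hlam1 hα hα1
  -- Every s with σ₀ ≤ σ ≤ 3 is within r of 3 + it; the 2 ensures r ≥ 1.
  set r : ℝ := 3 - min σ₀ 2 with hr
  have hr1 : 1 ≤ r := by linarith [min_le_right σ₀ 2]
  obtain ⟨C, hC, A, hCA⟩ := hGb (3 - 4 * r) (3 + 4 * r)
  obtain ⟨b, hb⟩ := pow_unbounded_of_one_lt (3 + 2 * r) (one_lt_two (α := ℝ))
  obtain ⟨c, hc⟩ := pow_unbounded_of_one_lt (C + 1) (one_lt_two (α := ℝ))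
  -- As t ≥ 2, constants are absorbed into powers of t: C + 1 ≤ t^c and X ≤ t^(b+1), where X bounds
  -- 1 + |s| on the disc. The exponent A + 1 makes t^B dominate X itself even if A = 0.
  set B : ℕ := c + (b + 1) * (A + 1) with hB
  refine ⟨B, r, B.cast_nonneg, hr1, fun s hs0 hs3 ht D hD hD1 hρ => ?_⟩
  set t : ℝ := s.im with htdef
  have ht0 : 0 < t := by linarith
  have hM : Real.exp (B * Real.log t) = t ^ B := by
    rw [Real.exp_nat_mul, Real.exp_log ht0]
  rw [hM]
  set X : ℝ := 4 + 4 * r + t with hX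
  have hX1 : 1 ≤ X := by linarith
  have hXM : (C + 1) * X ^ (A + 1) ≤ t ^ B := by
    have h1 : C + 1 ≤ t ^ c := hc.le.trans (pow_le_pow_left₀ zero_le_two ht c)
    have h2 : X ≤ t ^ (b + 1) := by
      have h3 : 3 + 2 * r ≤ t ^ b := hb.le.trans (pow_le_pow_left₀ zero_le_two ht b)
      rw [pow_succ]
      nlinarith
    rw [hB, pow_add t, pow_mul t]
    gcongr
  have hXpow : 1 ≤ X ^ A := one_le_pow₀ hX1
  have hX0 : 0 < X := by linarith
  have hCX : C * X ^ A ≤ t ^ B := by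
    refine le_trans ?_ hXM
    rw [pow_succ]
    calc C * X ^ A ≤ (C + 1) * (X ^ A * 1) := by
          rw [mul_one]
          gcongr
          linarith
      _ ≤ _ := by gcongr
  have hXX : X ≤ t ^ B := by
    refine le_trans ?_ hXM
    rw [pow_succ]
    calc X = 1 * (1 * X) := by ring
      _ ≤ _ := by
        gcongr
        linarith
  have hsc : s = 3 + t * I + (s.re - 3 : ℝ) := by
    apply Complex.ext <;> simp [htdef]
  set z : ℂ := ((s.re - 3 : ℝ) : ℂ) with hz
  set p : ℂ := 3 + t * I with hp
  have hpre : p.re = 3 := by simp [hp]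
  have hpim : p.im = t := by simp [hp]
  have hpn : ‖p‖ ≤ 3 + t := by
    refine (norm_add_le _ _).trans ?_
    simp [abs_of_pos ht0]
  have hzr : ‖z‖ ≤ r := by
    rw [hz, norm_real, Real.norm_eq_abs, abs_le]
    constructor <;> linarith [min_le_left σ₀ 2]
  have hbound : ∀ w ∈ Metric.closedBall (0 : ℂ) (4 * r), ‖G (p + w)‖ ≤ t ^ B := by
    intro w hw
    rw [mem_closedBall_zero_iff] at hw
    have hre := abs_le.1 ((abs_re_le_norm w).trans hw)
    have h1 := hCA (p + w) ⟨by rw [add_re, hpre]; linarith [hre.1],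
      by rw [add_re, hpre]; linarith [hre.2]⟩
    refine (h1.trans ?_).trans hCX
    gcongr
    linarith [norm_add_le p w]
  have hne1 : ∀ w : ℂ, 2 ≤ w.im → w ≠ 1 := fun w hw h => by
    rw [h, one_im] at hw; linarith
  have hF0 : 1 ≤ ‖G (p + 0)‖ := by
    rw [add_zero, hGL p (hne1 p (by linarith)), norm_mul]
    have h1 := half_le_norm_lerchZeta hlam hlam1 hα hα1 (s := p) hpre.ge
    have h2 : 2 ≤ ‖p - 1‖ := by
      have := abs_re_le_norm (p - 1)
      rw [sub_re, hpre, one_re] at this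
      norm_num at this
      exact this
    nlinarith
  have hlog2 : 1 / 2 < Real.log 2 := by linarith [Real.log_two_gt_d9]
  have hlogt : Real.log 2 ≤ Real.log t := Real.log_le_log zero_lt_two ht
  -- Since 2 log 2 > 1, this gives 2^n ≥ t^B.
  set n : ℕ := ⌈B * (2 * Real.log t)⌉₊ with hn
  have hMn : t ^ B ≤ 2 ^ n * ‖G (p + 0)‖ := by
    have h1 : t ^ B ≤ 2 ^ n := by
      rw [← Real.log_le_log_iff (by positivity) (by positivity), Real.log_pow, Real.log_pow]
      have h2 : (B : ℝ) * (2 * Real.log t) ≤ n := Nat.le_ceil _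
      nlinarith
    have : (0 : ℝ) < 2 ^ n := by positivity
    nlinarith
  refine ⟨n, ?_, ?_⟩
  · have := Nat.ceil_lt_add_one (a := (B : ℝ) * (2 * Real.log t)) (by
      have : 0 ≤ Real.log t := by linarith
      positivity)
    linarith
  · have key := norm_lower_bound hr1 hD hD1 hzr n (F := fun w => G (p + w))
      (hGd.comp (by fun_prop)) hbound hF0 hMn fun ρ _ hρ0 => by
        have hsub : z - ρ = s - (p + ρ) := by rw [hsc]; ring
        rw [hsub]
        -- G may vanish at 1 without L doing so, but 1 is at distance at least t ≥ 2 > D from s.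
        by_cases h1 : p + ρ = 1
        · rw [h1]
          have := abs_im_le_norm (s - 1)
          rw [sub_im, one_im, sub_zero] at this
          linarith [le_abs_self s.im]
        · refine hρ _ ⟨fun _ => h1, ?_⟩
          have h2 := hGL _ h1
          rw [hρ0] at h2
          exact (mul_eq_zero.1 h2.symm).resolve_left (sub_ne_zero.2 h1)
    refine key.trans ?_
    rw [← hsc, hGL s (hne1 s ht), norm_mul]
    gcongr
    refine le_trans ?_ hXX
    have h1 : s - 1 = p + z - 1 := by rw [← hsc]
    have h2 := norm_sub_le (p + z) 1
    have h3 := norm_add_le p z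
    rw [norm_one] at h2
    rw [h1]
    linarith

theorem proposition2 (lam α σ₀ : ℝ) (hlam : 0 < lam) (hlam1 : lam ≤ 1) (hα : 0 < α)
    (hα1 : α ≤ 1) :
    ∃ C : ℝ, 0 < C ∧ ∀ s : ℂ, σ₀ ≤ s.re → 2 ≤ s.im → lerchZeta lam α s ≠ 0 →
      1 / ‖lerchZeta lam α s‖ <
        Real.exp (C * (|Real.log (Metric.infDist s (lerchZeros lam α))| + 1) *
          Real.log s.im) := by
  obtain ⟨B, r, hB, hr, h⟩ :=
    LerchZeta.norm_lower_bound_of_re_le_three hlam hlam1 hα hα1 σ₀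
  have hlog8 : 0 ≤ Real.log (8 * r) := Real.log_nonneg (by linarith)
  -- With τ = log t: 3B from M³, 2 from 4 ≤ exp(2τ), the rest from n (l + log 8r) with n ≤ 2(B +
  -- 1)τ. The final constant E + 1 gives strictness.
  set E : ℝ := 2 + 3 * B + 2 * (B + 1) * (Real.log (8 * r) + 1) with hE
  have hE2 : 2 ≤ E := by
    have : 0 ≤ 2 * (B + 1) * (Real.log (8 * r) + 1) := by positivity
    linarith
  refine ⟨E + 1, by linarith, fun s hs0 ht hs => ?_⟩
  set d := Metric.infDist s (lerchZeros lam α) with hd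
  set l := |Real.log d| with hl
  have hl0 : 0 ≤ l := abs_nonneg _
  set τ := Real.log s.im with hτ
  have hlog2 : Real.log 2 ≤ τ := Real.log_le_log zero_lt_two ht
  have hτ0 : 0 < τ := (Real.log_pos one_lt_two).trans_le hlog2
  have hLpos : 0 < ‖lerchZeta lam α s‖ := norm_pos_iff.2 hs
  have hstrict : E * (l + 1) * τ < (E + 1) * (l + 1) * τ := by
    have : 0 < (l + 1) * τ := by positivity
    linarith
  refine lt_of_le_of_lt ?_ (Real.exp_lt_exp.2 hstrict)
  rcases le_total 3 s.re with h3 | h3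
  · have h1 := LerchZeta.half_le_norm_lerchZeta hlam hlam1 hα hα1 h3
    calc 1 / ‖lerchZeta lam α s‖ ≤ 1 / (1 / 2) := by gcongr
      _ = Real.exp (Real.log 2) := by rw [Real.exp_log zero_lt_two]; norm_num
      _ ≤ Real.exp (E * (l + 1) * τ) := by
        refine Real.exp_le_exp.2 (hlog2.trans ?_)
        have : 1 ≤ E * (l + 1) := by nlinarith
        nlinarith
  -- D = exp(-|log d|) is at most 1, and at most d if there are zeros. With no zeros, d = 0 and log
  -- 0 = 0 by convention, so D = 1 and the distance condition is vacuous.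
  · obtain ⟨n, hn, hlow⟩ := h s hs0 h3 ht (Real.exp (-l)) (Real.exp_pos _)
      (Real.exp_le_one_iff.2 (by linarith)) fun ρ hρ => by
        have hs1 : s ≠ 1 := fun h1 => by rw [h1, Complex.one_im] at ht; linarith
        have hdpos := LerchZeta.infDist_lerchZeros_pos hlam hlam1 hα hα1 hs1 hs ⟨ρ, hρ⟩
        calc Real.exp (-l) ≤ Real.exp (Real.log d) := Real.exp_le_exp.2 (neg_abs_le _)
          _ = d := Real.exp_log hdpos
          _ ≤ dist s ρ := Metric.infDist_le_dist_of_mem hρ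
          _ = ‖s - ρ‖ := dist_eq_norm _ _
    have h8 : Real.exp (-l) / (8 * r) = Real.exp (-(l + Real.log (8 * r))) := by
      rw [neg_add, Real.exp_add, Real.exp_neg (Real.log _), Real.exp_log (by linarith),
        div_eq_mul_inv]
    have h4 : (4 : ℝ) ≤ Real.exp (2 * τ) := by
      calc (4 : ℝ) = Real.exp (Real.log 2 + Real.log 2) := by
            rw [Real.exp_add, Real.exp_log zero_lt_two]; norm_num
        _ ≤ _ := Real.exp_le_exp.2 (by linarith)
    rw [h8, ← Real.exp_nat_mul, ← Real.exp_nat_mul, div_le_iff₀ (by positivity)] at hlow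
    have hupper : Real.exp (-(n * (l + Real.log (8 * r)))) ≤
        ‖lerchZeta lam α s‖ * Real.exp (B * τ + (2 * τ + 2 * (B * τ))) := by
      rw [Real.exp_add, Real.exp_add]
      push_cast at hlow
      calc Real.exp (-(n * (l + Real.log (8 * r))))
          ≤ Real.exp (B * τ) * ‖lerchZeta lam α s‖ * (4 * Real.exp (2 * (B * τ))) := by
            rw [← mul_neg]; exact hlow
        _ ≤ Real.exp (B * τ) * ‖lerchZeta lam α s‖ *
            (Real.exp (2 * τ) * Real.exp (2 * (B * τ))) := by gcongr
        _ = _ := by ring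
    have hfin : B * τ + (2 * τ + 2 * (B * τ)) + n * (l + Real.log (8 * r)) ≤
        E * (l + 1) * τ := by
      have h1 : n * (l + Real.log (8 * r)) ≤ (B + 1) * (2 * τ) * (l + Real.log (8 * r)) := by
        gcongr
      have h2 : 0 ≤ B * τ := by positivity
      have h3 : 0 ≤ (2 + 3 * B) * l * τ := by positivity
      have h4 : 0 ≤ 2 * (B + 1) * Real.log (8 * r) * l * τ := by positivity
      have h5 : 0 ≤ 2 * (B + 1) * τ := by positivity
      rw [hE]
      linarith
    rw [div_le_iff₀ hLpos]
    calc (1 : ℝ) = Real.exp (n * (l + Real.log (8 * r))) *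
          Real.exp (-(n * (l + Real.log (8 * r)))) := by
            rw [← Real.exp_add, add_neg_cancel, Real.exp_zero]
      _ ≤ Real.exp (n * (l + Real.log (8 * r))) *
          (‖lerchZeta lam α s‖ * Real.exp (B * τ + (2 * τ + 2 * (B * τ)))) := by gcongr
      _ = Real.exp (B * τ + (2 * τ + 2 * (B * τ)) + n * (l + Real.log (8 * r))) *
          ‖lerchZeta lam α s‖ := by
            rw [Real.exp_add _ (n * (l + Real.log (8 * r)))]; ring
      _ ≤ _ := by gcongr
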